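/- Let $\mathcal V_\uparrow,\mathcal V_\downarrow$ be complex $\mathbb Z_2$-graded vector spaces (of any dimension), and let $\pi_\sigma$ be an even (grading-preserving) projector on $\mathcal V_\sigma$, $\sigma=\uparrow,\downarrow$. Put $\bar\pi_\sigma=\mathbb I-\pi_\sigma$, $C^\sigma=\pi_\sigma-\bar\pi_\sigma$, let $P^\sigma_{12}(u\otimes v)=(-1)^{[u][v]}\,v\otimes u$ be the graded permutation on $\mathcal V_\sigma\otimes\mathcal V_\sigma$, and let $A_j$ denote the operator $A$ acting in the $j$-th tensor factor. With $\Sigma^\sigma_{12}=(\pi_\sigma)_1(\bar\pi_\sigma)_2+(\bar\pi_\sigma)_1(\pi_\sigma)_2$ define the universal XX $R$-matrices $$R^\sigma_{12}(\lambda)=\Sigma^\sigma_{12}P^\sigma_{12}+\Sigma^\sigma_{12}\sin\lambda+(\mathbb I\otimes\mathbb I-\Sigma^\sigma_{12})P^\sigma_{12}\cos\lambda ,$$ and denote by $R^\sigma_{ij}$ the same operator acting in the factors $i,j$ of a tensor power of $\mathcal V_\sigma$ (so that $R^\sigma_{21}=P^\sigma_{12}R^\sigma_{12}P^\sigma_{12}$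 and $R^\sigma_{13}=P^\sigma_{23}R^\sigma_{12}P^\sigma_{23}$). Let $U\in\mathbb C$ and let $h:\mathbb C\to\mathbb C$ be any function with $$\sinh(2h(\lambda))=U\sin(2\lambda)\qquad\text{for all }\lambda .$$ Write $\lambda_{ij}=\lambda_i-\lambda_j$, $\lambda'_{ij}=\lambda_i+\lambda_j$, $h_{ij}=h(\lambda_i)-h(\lambda_j)$, $h'_{ij}=h(\lambda_i)+h(\lambda_j)$. The Hubbard $R$-matrix, acting on the tensor product of the $\uparrow$ spaces and the $\downarrow$ spaces, is $$R^{\uparrow\downarrow}_{ij}(\lambda_i,\lambda_j)=R^\uparrow_{ij}(\lambda_{ij})R^\downarrow_{ij}(\lambda_{ij})+\frac{\sin\lambda_{ij}}{\sin\lambda'_{ij}}\tanh(h'_{ij})\,R^\uparrow_{ij}(\lambda'_{ij})C^\uparrow_iR^\downarrow_{ij}(\lambda'_{ij})C^\downarrow_i ,$$ defined when $\sin\lambda'_{ij}\neq0$ and $\cosh h'_{ij}\ne0$. Then: 1. (Yang–Baxter equation) For all $\lambda_1,\lambda_2,\lambda_3\in\mathbb C$ for which the three $R$-matrices are defined, $$R^{\uparrow\downarrow}_{12}(\lambda_1,\lambda_2)R^{\uparrow\downarrow}_{13}(\lambda_1,\lambda_3)R^{\uparrow\downarrow}_{23}(\lambda_2,\lambda_3)=R^{\uparrow\downarrow}_{23}(\lambda_2,\lambda_3)R^{\uparrow\downarrow}_{13}(\lambda_1,\lambda_3)R^{\uparrow\downarrow}_{12}(\lambda_1,\lambda_2).$$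 2. (Unitarity) For all $\lambda_1,\lambda_2$ with $\sin\lambda'_{12}\neq0$ and $\cosh h'_{12}\ne0$, $$R^{\uparrow\downarrow}_{12}(\lambda_1,\lambda_2)R^{\uparrow\downarrow}_{21}(\lambda_2,\lambda_1)=\Big(\cos^4\lambda_{12}-\Big(\frac{\sin\lambda_{12}}{\sin\lambda'_{12}}\tanh h'_{12}\Big)^2\cos^4\lambda'_{12}\Big)\,\mathbb I .$$ If moreover $\cosh h_{12}\neq0$, this coefficient equals $$\cos^2\lambda_{12}\,\big(\cos^2\lambda_{12}-(\tanh h_{12}\,\cos\lambda'_{12})^2\big).$$ 3. If $\sin\lambda'_{12}$, $\cos\lambda'_{12}$, $\cosh h'_{12}$, $\cosh h_{12}$ are all nonzero, then also $$\cos^4\lambda_{12}-\Big(\frac{\sin\lambda_{12}}{\sin\lambda'_{12}}\tanh h'_{12}\Big)^2=\cos^2\lambda_{12}\Big(\cos^2\lambda_{12}-\Big(\frac{\tanh h_{12}}{\cos\lambda'_{12}}\Big)^2\Big).$$ -/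

import Mathlib

open scoped TensorProduct

noncomputable section

namespace UniversalHubbard

section OneSpecies

variable {V : Type*} [AddCommGroup V] [Module ℂ V]

/-- The graded permutation `P₁₂` on `V ⊗ V`, `u ⊗ v ↦ (-1)^([u][v]) v ⊗ u`, for the
`ℤ₂`-graded complex vector space `V = 𝒱 0 ⊕ 𝒱 1`: Mathlib's graded braiding, transported
along `V ≃ ⨁ i, 𝒱 i`. -/
def P (𝒱 : ZMod 2 → Submodule ℂ V) [DirectSum.Decomposition 𝒱] : Module.End ℂ (V ⊗[ℂ] V) :=
  let e := DirectSum.decomposeLinearEquiv 𝒱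
  ((TensorProduct.congr e e).trans
    ((TensorProduct.gradedComm ℂ (fun i => 𝒱 i) (fun i => 𝒱 i)).trans
      (TensorProduct.congr e.symm e.symm))).toLinearMap

/-- The graded permutation on homogeneous vectors. -/
theorem P_tmul (𝒱 : ZMod 2 → Submodule ℂ V) [DirectSum.Decomposition 𝒱]
    {i j : ZMod 2} {u v : V} (hu : u ∈ 𝒱 i) (hv : v ∈ 𝒱 j) :
    P 𝒱 (u ⊗ₜ[ℂ] v) = (-1 : ℂ) ^ (i.val * j.val) • (v ⊗ₜ[ℂ] u) := by
  have e1 : DirectSum.decomposeLinearEquiv 𝒱 u = DirectSum.lof ℂ _ (fun i => 𝒱 i) i ⟨u, hu⟩ :=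
    DirectSum.decompose_of_mem 𝒱 hu
  have e2 : DirectSum.decomposeLinearEquiv 𝒱 v = DirectSum.lof ℂ _ (fun i => 𝒱 i) j ⟨v, hv⟩ :=
    DirectSum.decompose_of_mem 𝒱 hv
  have hs : ((-1 : ℤˣ) ^ (j * i) : ℤˣ) = (-1 : ℤˣ) ^ (i.val * j.val) := by
    fin_cases i <;> fin_cases j <;> rfl
  simp only [P, LinearEquiv.coe_coe, LinearEquiv.trans_apply, TensorProduct.congr_tmul]
  rw [e1, e2, TensorProduct.gradedComm_of_tmul_of, hs, Units.smul_def,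
    ← Int.cast_smul_eq_zsmul ℂ, map_smul, TensorProduct.congr_tmul, ← e1, ← e2]
  simp

/-- `A₁ = A ⊗ 𝕀`. -/
def op1 (A : Module.End ℂ V) : Module.End ℂ (V ⊗[ℂ] V) := TensorProduct.map A 1

/-- `A₂ = 𝕀 ⊗ A` (without signs: it is only used for even `A`). -/
def op2 (A : Module.End ℂ V) : Module.End ℂ (V ⊗[ℂ] V) := TensorProduct.map 1 A

/-- `Σ₁₂ = π₁ π̄₂ + π̄₁ π₂`, with `π̄ = 𝕀 - π`. -/
def Sig (π : Module.End ℂ V) : Module.End ℂ (V ⊗[ℂ] V) :=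
  op1 π * op2 (1 - π) + op1 (1 - π) * op2 π

/-- The parity operator `C = π - π̄`. -/
def C (π : Module.End ℂ V) : Module.End ℂ V := π - (1 - π)

/-- The `R`-matrix of the universal XX model:
`R₁₂(λ) = Σ₁₂ P₁₂ + Σ₁₂ sin λ + (𝕀 ⊗ 𝕀 - Σ₁₂) P₁₂ cos λ`. -/
def RXX (𝒱 : ZMod 2 → Submodule ℂ V) [DirectSum.Decomposition 𝒱] (π : Module.End ℂ V) (l : ℂ) :
    Module.End ℂ (V ⊗[ℂ] V) :=
  Sig π * P 𝒱 + Complex.sin l • Sig π + Complex.cos l • ((1 - Sig π) * P 𝒱)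

/-- `X₂₁ = P₁₂ X₁₂ P₁₂`. -/
def leg21 (𝒱 : ZMod 2 → Submodule ℂ V) [DirectSum.Decomposition 𝒱]
    (X : Module.End ℂ (V ⊗[ℂ] V)) : Module.End ℂ (V ⊗[ℂ] V) :=
  P 𝒱 * X * P 𝒱

/-- `X₁₂` on `V ⊗ V ⊗ V`: the operator `X` acting in the factors 1 and 2. -/
def leg12 (X : Module.End ℂ (V ⊗[ℂ] V)) : Module.End ℂ (V ⊗[ℂ] V ⊗[ℂ] V) :=
  LinearMap.rTensor V X

/-- `X₂₃` on `V ⊗ V ⊗ V`: the (even) operator `X` acting in the factors 2 and 3. -/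
def leg23 (X : Module.End ℂ (V ⊗[ℂ] V)) : Module.End ℂ (V ⊗[ℂ] V ⊗[ℂ] V) :=
  (TensorProduct.assoc ℂ V V V).symm.toLinearMap ∘ₗ LinearMap.lTensor V X ∘ₗ
    (TensorProduct.assoc ℂ V V V).toLinearMap

/-- `X₁₃ = P₂₃ X₁₂ P₂₃` on `V ⊗ V ⊗ V`: the operator `X` acting in the factors 1 and 3. -/
def leg13 (𝒱 : ZMod 2 → Submodule ℂ V) [DirectSum.Decomposition 𝒱]
    (X : Module.End ℂ (V ⊗[ℂ] V)) : Module.End ℂ (V ⊗[ℂ] V ⊗[ℂ] V) :=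
  leg23 (P 𝒱) * leg12 X * leg23 (P 𝒱)

end OneSpecies

section TwoSpecies

variable {V W E F : Type*} [AddCommGroup V] [Module ℂ V] [AddCommGroup W] [Module ℂ W]
  [AddCommGroup E] [Module ℂ E] [AddCommGroup F] [Module ℂ F]

/-- The Hubbard coupling coefficient
`sin(λ₁ - λ₂) / sin(λ₁ + λ₂) * tanh(h(λ₁) + h(λ₂))`. -/
def coupling (h : ℂ → ℂ) (l₁ l₂ : ℂ) : ℂ :=
  Complex.sin (l₁ - l₂) / Complex.sin (l₁ + l₂) * Complex.tanh (h l₁ + h l₂)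

/-- The Hubbard `R`-matrix
`R↑(λ₁₂) R↓(λ₁₂) + (sin λ₁₂ / sin λ'₁₂) tanh(h'₁₂) R↑(λ'₁₂) C₁↑ R↓(λ'₁₂) C₁↓`
in auxiliary space notation. The `↑` operators act on `E`, the `↓` operators on `F`, and the
Hubbard `R`-matrix on `E ⊗ F`; `ι` and `κ` place an operator on `V ⊗ V` (resp. `W ⊗ W`) into the
chosen pair of factors of `E` (resp. `F`). -/
def hubbardR (𝒱 : ZMod 2 → Submodule ℂ V) [DirectSum.Decomposition 𝒱]
    (𝒲 : ZMod 2 → Submodule ℂ W) [DirectSum.Decomposition 𝒲]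
    (πup : Module.End ℂ V) (πdn : Module.End ℂ W) (h : ℂ → ℂ)
    (ι : Module.End ℂ (V ⊗[ℂ] V) → Module.End ℂ E) (κ : Module.End ℂ (W ⊗[ℂ] W) → Module.End ℂ F)
    (l₁ l₂ : ℂ) : Module.End ℂ (E ⊗[ℂ] F) :=
  TensorProduct.map (ι (RXX 𝒱 πup (l₁ - l₂))) (κ (RXX 𝒲 πdn (l₁ - l₂))) +
    coupling h l₁ l₂ •
      TensorProduct.map
        (ι (RXX 𝒱 πup (l₁ + l₂) * op1 (C πup)))
        (κ (RXX 𝒲 πdn (l₁ + l₂) * op1 (C πdn)))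

variable (𝒱 : ZMod 2 → Submodule ℂ V) [DirectSum.Decomposition 𝒱]
  (𝒲 : ZMod 2 → Submodule ℂ W) [DirectSum.Decomposition 𝒲]
  (πup : Module.End ℂ V) (πdn : Module.End ℂ W) (h : ℂ → ℂ) (l m : ℂ)

/-- `R↑↓₁₂(l, m)` on two sites, that is on `(V ⊗ V) ⊗ (W ⊗ W)`. -/
def hubbard12 : Module.End ℂ ((V ⊗[ℂ] V) ⊗[ℂ] (W ⊗[ℂ] W)) :=
  hubbardR 𝒱 𝒲 πup πdn h id id l m

/-- `R↑↓₂₁(l, m)` on two sites. -/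
def hubbard21 : Module.End ℂ ((V ⊗[ℂ] V) ⊗[ℂ] (W ⊗[ℂ] W)) :=
  hubbardR 𝒱 𝒲 πup πdn h (leg21 𝒱) (leg21 𝒲) l m

/-- `R↑↓₁₂(l, m)` on three sites, that is on `(V ⊗ V ⊗ V) ⊗ (W ⊗ W ⊗ W)`. -/
def hubbardThree12 : Module.End ℂ ((V ⊗[ℂ] V ⊗[ℂ] V) ⊗[ℂ] (W ⊗[ℂ] W ⊗[ℂ] W)) :=
  hubbardR 𝒱 𝒲 πup πdn h leg12 leg12 l m

/-- `R↑↓₁₃(l, m)` on three sites. -/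
def hubbardThree13 : Module.End ℂ ((V ⊗[ℂ] V ⊗[ℂ] V) ⊗[ℂ] (W ⊗[ℂ] W ⊗[ℂ] W)) :=
  hubbardR 𝒱 𝒲 πup πdn h (leg13 𝒱) (leg13 𝒲) l m

/-- `R↑↓₂₃(l, m)` on three sites. -/
def hubbardThree23 : Module.End ℂ ((V ⊗[ℂ] V ⊗[ℂ] V) ⊗[ℂ] (W ⊗[ℂ] W ⊗[ℂ] W)) :=
  hubbardR 𝒱 𝒲 πup πdn h leg23 leg23 l m

end TwoSpecies

end UniversalHubbard

end

/-!
Multiplied by graded permutations, the `R`-matrices lose all signs: in braid form `Ř = P R`, the XX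
`R`-matrix is a polynomial in the hopping operator `e = P Σ`. The hopping operators of two
neighbouring links satisfy free-fermion relations, which make the words in them matrix units up to
a central parity. Identities between them thus reduce to the `3 × 3` matrices that hop one odd
colour between three sites.

Expand both sides of the Yang–Baxter equation into triples of XX matrices, some of whose factors are
decorated with `C` and carry the spectral parameter `λ'` instead of `λ`. In one species, the triples
with an even number of decorations satisfy the Yang–Baxter equation, `T = S`, and the triples with
an odd number violate it by a multiple of one common operator, `T - S = ε D` with an explicit scalar
`ε`. For the tensor product of the two species,
`T ⊗ T' - S ⊗ S' = (ε / 2) (D ⊗ (T' + S') + (T + S) ⊗ D')`,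
so the violations cancel as soon as the sum of the `T + S`, weighted with `ε` and the couplings,
vanishes. That is a relation between the three couplings, and `sinh (2 h) = U sin (2 λ)` implies it.
-/

noncomputable section

namespace UniversalHubbard

section XXBraid

variable {A B : Type*} [Ring A] [Algebra ℂ A] [Ring B] [Algebra ℂ B]

/-- The braid form `Ř = P R` of the XX `R`-matrix, as a function of the hopping operator
`e = P Σ`. -/
def xxBraid (e : A) (l : ℂ) : A :=
  e ^ 2 + Complex.sin l • e + Complex.cos l • (1 - e ^ 2)

theorem map_xxBraid (f : A →ₐ[ℂ] B) (e : A) (l : ℂ) : f (xxBraid e l) = xxBraid (f e) l := by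
  simp only [xxBraid, map_add, map_sub, map_smul, map_pow, map_one]

theorem xxBraid_neg_left (e : A) (l : ℂ) : xxBraid (-e) l = xxBraid e (-l) := by
  rw [xxBraid, xxBraid, neg_sq, smul_neg, Complex.sin_neg, Complex.cos_neg, neg_smul]

theorem semiconjBy_xxBraid {g e e' : A} (h : SemiconjBy g e e') (l : ℂ) :
    SemiconjBy g (xxBraid e l) (xxBraid e' l) :=
  ((h.pow_right 2).add_right (h.smul_right _)).add_right
    (((SemiconjBy.one_right g).sub_right (h.pow_right 2)).smul_right _)

theorem xxBraid_mul_xxBraid_neg {e : A} (he : e ^ 3 = e) (l : ℂ) :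
    xxBraid e l * xxBraid e (-l) = Complex.cos l ^ 2 • (1 : A) := by
  have he' : e * e * e = e := by rw [← pow_three', he]
  have hl := Complex.sin_sq_add_cos_sq l
  simp only [xxBraid, Complex.sin_neg, Complex.cos_neg, pow_two e, add_mul, mul_add, sub_mul,
    mul_sub, smul_mul_assoc, mul_smul_comm, ← mul_assoc, one_mul, mul_one, he']
  match_scalars <;> grind

theorem xxBraid_commute (e : A) (l m : ℂ) : Commute (xxBraid e l) (xxBraid e m) :=
  semiconjBy_xxBraid (Commute.symm (semiconjBy_xxBraid (Commute.refl e) l)) m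

/-- The two `R`-matrices of one species that enter the Hubbard `R`-matrix, in braid form: the XX
`R`-matrix at the difference of the spectral parameters, and the one at their sum decorated by the
parity operator `c`. -/
def decorated (e c : A) (x y : ℂ) : Bool → A
  | false => xxBraid e (x - y)
  | true => xxBraid e (x + y) * c

theorem map_decorated (f : A →ₐ[ℂ] B) (e c : A) (x y : ℂ) (a : Bool) :
    f (decorated e c x y a) = decorated (f e) (f c) x y a := by
  cases a <;> simp only [decorated, map_mul, map_xxBraid]

theorem semiconjBy_decorated {g e e' c c' : A} (he : SemiconjBy g e e') (hc : SemiconjBy g c c')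
    (x y : ℂ) : ∀ a, SemiconjBy g (decorated e c x y a) (decorated e' c' x y a)
  | false => semiconjBy_xxBraid he _
  | true => (semiconjBy_xxBraid he _).mul_right hc

section Unitarity

variable {e c : A}

theorem decorated_false_mul_swap (he : e ^ 3 = e) (x y : ℂ) :
    decorated e c x y false * decorated e c y x false = Complex.cos (x - y) ^ 2 • (1 : A) := by
  rw [decorated, decorated, ← neg_sub x y, xxBraid_mul_xxBraid_neg he]

theorem mul_xxBraid_of_anticommute (hce : SemiconjBy c e (-e)) (l : ℂ) :
    c * xxBraid e l = xxBraid e (-l) * c := by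
  rw [← xxBraid_neg_left]
  exact semiconjBy_xxBraid hce l

theorem decorated_true_mul_swap (he : e ^ 3 = e) (hc : c ^ 2 = 1) (hce : SemiconjBy c e (-e))
    (x y : ℂ) :
    decorated e c x y true * decorated e c y x true = Complex.cos (x + y) ^ 2 • (1 : A) := by
  rw [decorated, decorated, add_comm y, mul_assoc, ← mul_assoc c, mul_xxBraid_of_anticommute hce,
    mul_assoc, ← pow_two, hc, mul_one, xxBraid_mul_xxBraid_neg he]

theorem decorated_true_mul_false (hce : SemiconjBy c e (-e)) (x y : ℂ) :
    decorated e c x y true * decorated e c y x false =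
      decorated e c x y false * decorated e c y x true := by
  rw [decorated, decorated, decorated, decorated, mul_assoc, mul_xxBraid_of_anticommute hce,
    neg_sub, ← mul_assoc, (xxBraid_commute e _ _).eq, mul_assoc, add_comm y]

end Unitarity

/-- The braid form `Ř = P R` of the Hubbard `R`-matrix with coupling `k`, built from the hopping
and parity operators `e`, `c` of one species and `e'`, `c'` of the other. -/
def hubbardBraid (k : ℂ) (e c : A) (e' c' : B) (x y : ℂ) : A ⊗[ℂ] B :=
  ∑ a : Bool, k ^ a.toNat • (decorated e c x y a ⊗ₜ decorated e' c' x y a)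

theorem semiconjBy_hubbardBraid {g e₁ e₂ c₁ c₂ : A} {g' e₁' e₂' c₁' c₂' : B}
    (he : SemiconjBy g e₁ e₂) (hc : SemiconjBy g c₁ c₂) (he' : SemiconjBy g' e₁' e₂')
    (hc' : SemiconjBy g' c₁' c₂') (k x y : ℂ) :
    SemiconjBy (g ⊗ₜ[ℂ] g') (hubbardBraid k e₁ c₁ e₁' c₁' x y)
      (hubbardBraid k e₂ c₂ e₂' c₂' x y) := by
  have h (a : Bool) := congrArg₂ (· ⊗ₜ[ℂ] ·) (semiconjBy_decorated he hc x y a).eq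
    (semiconjBy_decorated he' hc' x y a).eq
  simp only [SemiconjBy, hubbardBraid, Finset.mul_sum, Finset.sum_mul, mul_smul_comm,
    smul_mul_assoc, Algebra.TensorProduct.tmul_mul_tmul, h]

theorem hubbardBraid_mul_swap {e c : A} {e' c' : B} (he : e ^ 3 = e) (hc : c ^ 2 = 1)
    (hce : SemiconjBy c e (-e)) (he' : e' ^ 3 = e') (hc' : c' ^ 2 = 1)
    (hce' : SemiconjBy c' e' (-e')) (k x y : ℂ) :
    hubbardBraid k e c e' c' x y * hubbardBraid (-k) e c e' c' y x =
      (Complex.cos (x - y) ^ 4 - k ^ 2 * Complex.cos (x + y) ^ 4) • 1 := by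
  simp only [hubbardBraid, Fintype.sum_bool, Bool.toNat_true, Bool.toNat_false, pow_one, pow_zero,
    one_smul, add_mul, mul_add, smul_mul_assoc, mul_smul_comm,
    Algebra.TensorProduct.tmul_mul_tmul, decorated_false_mul_swap he, decorated_false_mul_swap he',
    decorated_true_mul_swap he hc hce, decorated_true_mul_swap he' hc' hce',
    decorated_true_mul_false hce, decorated_true_mul_false hce', TensorProduct.smul_tmul_smul,
    ← Algebra.TensorProduct.one_def]
  module

end XXBraid

section Triples

variable {A B : Type*} [Ring A] [Ring B]

/-- The parity operator of the left site of two neighbouring links, from the hopping operator `e₂`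
of the right link and the total parity `κ` of the three sites. -/
def parityLeft (e₂ κ : A) : A := κ * (1 - 2 * e₂ ^ 2)

/-- The parity operator of the middle site of two neighbouring links, from their hopping operators
`e₁`, `e₂` and the total parity `κ` of the three sites. -/
def parityMiddle (e₁ e₂ κ : A) : A := κ * ((1 - 2 * e₁ ^ 2) * (1 - 2 * e₂ ^ 2))

theorem commute_one_sub_two_mul_sq {e κ : A} (h : Commute κ e) : Commute κ (1 - 2 * e ^ 2) :=
  (Commute.one_right κ).sub_right ((Commute.ofNat_right κ 2).mul_right (h.pow_right 2))

variable [Algebra ℂ A] [Algebra ℂ B]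

/-- The summand of the left-hand side of the Yang–Baxter equation in braid form in which precisely
the factors marked `true` in `i` are decorated. -/
def leftTriple (e₁ e₂ κ : A) (x y z : ℂ) (i : Bool × Bool × Bool) : A :=
  decorated e₂ (parityMiddle e₁ e₂ κ) x y i.1 * decorated e₁ (parityLeft e₂ κ) x z i.2.1 *
    decorated e₂ (parityMiddle e₁ e₂ κ) y z i.2.2

/-- The right-hand counterpart of `leftTriple`. The components of `i` refer to the pairs of
spectral parameters `(x, y)`, `(x, z)`, `(y, z)` in this order, so the factors come in reverse. -/
def rightTriple (e₁ e₂ κ : A) (x y z : ℂ) (i : Bool × Bool × Bool) : A :=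
  decorated e₁ (parityLeft e₂ κ) y z i.2.2 * decorated e₂ (parityMiddle e₁ e₂ κ) x z i.2.1 *
    decorated e₁ (parityLeft e₂ κ) x y i.1

/-- The left-hand and the right-hand triple with decorations `i`, added up. -/
def tripleSum (e₁ e₂ κ : A) (x y z : ℂ) (i : Bool × Bool × Bool) : A :=
  leftTriple e₁ e₂ κ x y z i + rightTriple e₁ e₂ κ x y z i

/-- The number of decorated factors of a triple. -/
def decorationCount (i : Bool × Bool × Bool) : ℕ :=
  i.1.toNat + i.2.1.toNat + i.2.2.toNat

theorem map_parityLeft (f : A →ₐ[ℂ] B) (e₂ κ : A) :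
    f (parityLeft e₂ κ) = parityLeft (f e₂) (f κ) := by
  simp only [parityLeft, map_mul, map_sub, map_one, map_ofNat, map_pow]

theorem map_parityMiddle (f : A →ₐ[ℂ] B) (e₁ e₂ κ : A) :
    f (parityMiddle e₁ e₂ κ) = parityMiddle (f e₁) (f e₂) (f κ) := by
  simp only [parityMiddle, map_mul, map_sub, map_one, map_ofNat, map_pow]

theorem map_leftTriple (f : A →ₐ[ℂ] B) (e₁ e₂ κ : A) (x y z : ℂ) (i : Bool × Bool × Bool) :
    f (leftTriple e₁ e₂ κ x y z i) = leftTriple (f e₁) (f e₂) (f κ) x y z i := by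
  simp only [leftTriple, map_mul, map_decorated, map_parityLeft, map_parityMiddle]

theorem map_rightTriple (f : A →ₐ[ℂ] B) (e₁ e₂ κ : A) (x y z : ℂ) (i : Bool × Bool × Bool) :
    f (rightTriple e₁ e₂ κ x y z i) = rightTriple (f e₁) (f e₂) (f κ) x y z i := by
  simp only [rightTriple, map_mul, map_decorated, map_parityLeft, map_parityMiddle]

theorem map_tripleSum (f : A →ₐ[ℂ] B) (e₁ e₂ κ : A) (x y z : ℂ) (i : Bool × Bool × Bool) :
    f (tripleSum e₁ e₂ κ x y z i) = tripleSum (f e₁) (f e₂) (f κ) x y z i := by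
  rw [tripleSum, map_add, map_leftTriple, map_rightTriple, tripleSum]

theorem decorated_mul_right {e κ : A} (hκ : Commute κ e) (c : A) (x y : ℂ) (a : Bool) :
    decorated e (κ * c) x y a = κ ^ a.toNat * decorated e c x y a := by
  cases a
  · simp [decorated]
  · have h : κ * xxBraid e (x + y) = xxBraid e (x + y) * κ := semiconjBy_xxBraid hκ _
    simp [decorated, ← mul_assoc, h]

theorem decorated_parityLeft {e₁ κ : A} (h₁ : Commute κ e₁) (e₂ : A) (x y : ℂ) (a : Bool) :
    decorated e₁ (parityLeft e₂ κ) x y a =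
      κ ^ a.toNat * decorated e₁ (parityLeft e₂ 1) x y a := by
  rw [parityLeft, parityLeft, one_mul, decorated_mul_right h₁]

theorem decorated_parityMiddle {e₂ κ : A} (h₂ : Commute κ e₂) (e₁ : A) (x y : ℂ) (a : Bool) :
    decorated e₂ (parityMiddle e₁ e₂ κ) x y a =
      κ ^ a.toNat * decorated e₂ (parityMiddle e₁ e₂ 1) x y a := by
  rw [parityMiddle, parityMiddle, one_mul, decorated_mul_right h₂]

section TotalParity

variable {e₁ e₂ κ : A} (h₁ : Commute κ e₁) (h₂ : Commute κ e₂)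
include h₁ h₂

theorem commute_decorated_parityLeft (x y : ℂ) (a : Bool) :
    Commute κ (decorated e₁ (parityLeft e₂ 1) x y a) :=
  semiconjBy_decorated h₁ ((Commute.one_right κ).mul_right (commute_one_sub_two_mul_sq h₂)) x y a

theorem commute_decorated_parityMiddle (x y : ℂ) (a : Bool) :
    Commute κ (decorated e₂ (parityMiddle e₁ e₂ 1) x y a) :=
  semiconjBy_decorated h₂ ((Commute.one_right κ).mul_right
    ((commute_one_sub_two_mul_sq h₁).mul_right (commute_one_sub_two_mul_sq h₂))) x y a

theorem leftTriple_eq_pow_mul (x y z : ℂ) (i : Bool × Bool × Bool) :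
    leftTriple e₁ e₂ κ x y z i = κ ^ decorationCount i * leftTriple e₁ e₂ 1 x y z i := by
  have hM := (commute_decorated_parityMiddle h₁ h₂ x y i.1).pow_left i.2.1.toNat
  have hL := (commute_decorated_parityLeft h₁ h₂ x z i.2.1).pow_left i.2.2.toNat
  have hM' := (commute_decorated_parityMiddle h₁ h₂ x y i.1).pow_left i.2.2.toNat
  rw [leftTriple, decorated_parityMiddle h₂, decorated_parityLeft h₁,
    decorated_parityMiddle h₂, hM.symm.mul_mul_mul_comm, ← pow_add,
    (hM'.mul_right hL).symm.mul_mul_mul_comm, ← pow_add, leftTriple, decorationCount]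

theorem rightTriple_eq_pow_mul (x y z : ℂ) (i : Bool × Bool × Bool) :
    rightTriple e₁ e₂ κ x y z i = κ ^ decorationCount i * rightTriple e₁ e₂ 1 x y z i := by
  have hL := (commute_decorated_parityLeft h₁ h₂ y z i.2.2).pow_left i.2.1.toNat
  have hM := (commute_decorated_parityMiddle h₁ h₂ x z i.2.1).pow_left i.1.toNat
  have hL' := (commute_decorated_parityLeft h₁ h₂ y z i.2.2).pow_left i.1.toNat
  rw [rightTriple, decorated_parityMiddle h₂, decorated_parityLeft h₁,
    decorated_parityLeft h₁, hL.symm.mul_mul_mul_comm, ← pow_add,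
    (hL'.mul_right hM).symm.mul_mul_mul_comm, ← pow_add, rightTriple, decorationCount,
    add_comm i.2.2.toNat, add_comm, add_assoc]

theorem tripleSum_eq_pow_mul (x y z : ℂ) (i : Bool × Bool × Bool) :
    tripleSum e₁ e₂ κ x y z i = κ ^ decorationCount i * tripleSum e₁ e₂ 1 x y z i := by
  rw [tripleSum, leftTriple_eq_pow_mul h₁ h₂, rightTriple_eq_pow_mul h₁ h₂, ← mul_add, tripleSum]

end TotalParity

end Triples

section Couplings

open Complex

/-- The product of the couplings of the decorated factors of a triple. -/
def couplingWeight (k₁₂ k₁₃ k₂₃ : ℂ) (i : Bool × Bool × Bool) : ℂ :=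
  k₁₂ ^ i.1.toNat * k₁₃ ^ i.2.1.toNat * k₂₃ ^ i.2.2.toNat

/-- The condition on the three couplings under which the Hubbard `R`-matrices satisfy the
Yang–Baxter equation at the spectral parameters `x`, `y`, `z`: together with their product they
belong to an explicit two-parameter family. -/
def HubbardCouplings (x y z k₁₂ k₁₃ k₂₃ : ℂ) : Prop :=
  ∃ k t : ℂ,
    k₁₂ = k * (sin (x - y) * cos (x - y)) + t * (sin (x - y) * (sin (x + z) * sin (y + z))) ∧
    k₁₃ = k * (sin (x - z) * cos (x - z)) + t * (sin (x - z) * (sin (x + y) * sin (y + z))) ∧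
    k₂₃ = k * (sin (y - z) * cos (y - z)) + t * (sin (y - z) * (sin (x + y) * sin (x + z))) ∧
    k₁₂ * k₁₃ * k₂₃ = t * (sin (x - y) * sin (x - z) * sin (y - z))

end Couplings

/-- The model in which the Yang–Baxter equation is verified. If exactly one of the sites `0`, `1`,
`2` carries the odd colour, then its position is a basis of a three-dimensional space on which the
matrices act; the summand `ℂ` accounts for the states in which all colours agree. -/
abbrev OneParticle := Matrix (Fin 3) (Fin 3) ℂ × ℂ

namespace OneParticle

open Complex

/-- The hop across the left link. -/
def hopLeft : OneParticle := (!![0, 1, 0; 1, 0, 0; 0, 0, 0], 0)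

/-- The hop across the right link. -/
def hopRight : OneParticle := (!![0, 0, 0; 0, 0, 1; 0, 1, 0], 0)

theorem xxBraid_hopLeft (l : ℂ) :
    xxBraid hopLeft l = (!![1, sin l, 0; sin l, 1, 0; 0, 0, cos l], cos l) := by
  ext i j
  · fin_cases i <;> fin_cases j <;> simp [xxBraid, hopLeft, pow_two]
  · simp [xxBraid, hopLeft]

theorem xxBraid_hopRight (l : ℂ) :
    xxBraid hopRight l = (!![cos l, 0, 0; 0, 1, sin l; 0, sin l, 1], cos l) := by
  ext i j
  · fin_cases i <;> fin_cases j <;> simp [xxBraid, hopRight, pow_two]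
  · simp [xxBraid, hopRight]

theorem parityLeft_hopRight : parityLeft hopRight 1 = (Matrix.diagonal ![1, -1, -1], 1) := by
  rw [parityLeft, two_mul]
  ext i j
  · fin_cases i <;> fin_cases j <;> norm_num [hopRight, pow_two, Matrix.one_apply, Fin.ext_iff]
  · simp [hopRight]

theorem parityMiddle_hop : parityMiddle hopLeft hopRight 1 = (Matrix.diagonal ![-1, 1, -1], 1) := by
  have h : (1 - 2 * hopLeft ^ 2 : OneParticle) = (Matrix.diagonal ![-1, -1, 1], 1) := by
    rw [two_mul]
    ext i j
    · fin_cases i <;> fin_cases j <;> norm_num [hopLeft, pow_two, Matrix.one_apply, Fin.ext_iff]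
    · simp [hopLeft]
  rw [parityMiddle, one_mul, h, ← one_mul (1 - 2 * hopRight ^ 2), ← parityLeft,
    parityLeft_hopRight, Prod.mk_mul_mk, Matrix.diagonal_mul_diagonal]
  ext i j
  · fin_cases i <;> fin_cases j <;> simp
  · simp

theorem decorated_hopLeft_false (x y : ℂ) :
    decorated hopLeft (parityLeft hopRight 1) x y false =
      (!![1, sin (x - y), 0; sin (x - y), 1, 0; 0, 0, cos (x - y)], cos (x - y)) := by
  rw [decorated, xxBraid_hopLeft]

theorem decorated_hopRight_false (x y : ℂ) :
    decorated hopRight (parityMiddle hopLeft hopRight 1) x y false =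
      (!![cos (x - y), 0, 0; 0, 1, sin (x - y); 0, sin (x - y), 1], cos (x - y)) := by
  rw [decorated, xxBraid_hopRight]

theorem decorated_hopLeft_true (x y : ℂ) :
    decorated hopLeft (parityLeft hopRight 1) x y true =
      (!![1, -sin (x + y), 0; sin (x + y), -1, 0; 0, 0, -cos (x + y)], cos (x + y)) := by
  rw [decorated, xxBraid_hopLeft, parityLeft_hopRight]
  ext i j
  · fin_cases i <;> fin_cases j <;> simp [Matrix.vecMul_diagonal]
  · simp

theorem decorated_hopRight_true (x y : ℂ) :
    decorated hopRight (parityMiddle hopLeft hopRight 1) x y true =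
      (!![-cos (x + y), 0, 0; 0, 1, -sin (x + y); 0, sin (x + y), -1], cos (x + y)) := by
  rw [decorated, xxBraid_hopRight, parityMiddle_hop]
  ext i j
  · fin_cases i <;> fin_cases j <;> simp [Matrix.vecMul_diagonal]
  · simp

/-- The coefficients with which the triples of the one-particle model violate the Yang–Baxter
equation: the violations vanish for even numbers of decorations and are proportional to the common
matrix `defect` for odd ones. -/
def decorationSign : Bool × Bool × Bool → ℂ
  | (true, false, false) => 1
  | (false, true, false) => -1
  | (false, false, true) => 1
  | (true, true, true) => -1
  | _ => 0

/-- The common violation of the Yang–Baxter equation by the triples with an odd number of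
decorations. -/
def defect (x y z : ℂ) : OneParticle :=
  (-2 : ℂ) • (!![cos x * cos z, -(sin y * cos z), 0;
                 cos x * sin y, -1, cos y * sin z;
                 0, -(sin x * cos y), sin x * sin z], 0)

theorem leftTriple_eq (x y z : ℂ) (i : Bool × Bool × Bool) :
    leftTriple hopLeft hopRight 1 x y z i =
      rightTriple hopLeft hopRight 1 x y z i + decorationSign i • defect x y z := by
  have hx := sin_sq_add_cos_sq x
  have hy := sin_sq_add_cos_sq y
  have hz := sin_sq_add_cos_sq z
  rcases i with ⟨_ | _, _ | _, _ | _⟩ <;>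
    simp only [leftTriple, rightTriple, decorated_hopLeft_true, decorated_hopLeft_false,
      decorated_hopRight_true, decorated_hopRight_false, decorationSign, defect, Prod.mk_mul_mk,
      Prod.smul_mk, Prod.mk_add_mk, Prod.mk.injEq, Matrix.mul_fin_three, Matrix.smul_of,
      Matrix.smul_cons, Matrix.smul_empty, smul_eq_mul, Matrix.of_add_of, Matrix.add_cons,
      Matrix.head_cons, Matrix.tail_cons, Matrix.empty_add_empty, EmbeddingLike.apply_eq_iff_eq,
      Matrix.vecCons_inj, and_true, sin_add, cos_add, sin_sub, cos_sub] <;>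
    and_intros <;> grind

theorem sum_smul_tripleSum (x y z k t : ℂ) :
    (k * (sin (x - y) * cos (x - y)) + t * (sin (x - y) * (sin (x + z) * sin (y + z)))) •
        tripleSum hopLeft hopRight 1 x y z (true, false, false) +
      (k * (sin (y - z) * cos (y - z)) + t * (sin (y - z) * (sin (x + y) * sin (x + z)))) •
        tripleSum hopLeft hopRight 1 x y z (false, false, true) =
    (k * (sin (x - z) * cos (x - z)) + t * (sin (x - z) * (sin (x + y) * sin (y + z)))) •
        tripleSum hopLeft hopRight 1 x y z (false, true, false) +
      (t * (sin (x - y) * sin (x - z) * sin (y - z))) •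
        tripleSum hopLeft hopRight 1 x y z (true, true, true) := by
  have hx := sin_sq_add_cos_sq x
  have hy := sin_sq_add_cos_sq y
  have hz := sin_sq_add_cos_sq z
  simp only [tripleSum, leftTriple, rightTriple, decorated_hopLeft_true, decorated_hopLeft_false,
    decorated_hopRight_true, decorated_hopRight_false, Prod.mk_mul_mk, Prod.smul_mk,
    Prod.mk_add_mk, Prod.mk.injEq, Matrix.mul_fin_three, Matrix.smul_of, Matrix.smul_cons,
    Matrix.smul_empty, smul_eq_mul, Matrix.of_add_of, Matrix.add_cons, Matrix.head_cons,
    Matrix.tail_cons, Matrix.empty_add_empty, EmbeddingLike.apply_eq_iff_eq, Matrix.vecCons_inj,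
    and_true, sin_add, cos_add, sin_sub, cos_sub]
  and_intros <;> grind

theorem weighted_sum_tripleSum {x y z k₁₂ k₁₃ k₂₃ : ℂ} (hk : HubbardCouplings x y z k₁₂ k₁₃ k₂₃) :
    ∑ i, (couplingWeight k₁₂ k₁₃ k₂₃ i * decorationSign i) •
      tripleSum hopLeft hopRight 1 x y z i = 0 := by
  obtain ⟨k, t, h₁₂, h₁₃, h₂₃, h⟩ := hk
  have hsum := sum_smul_tripleSum x y z k t
  rw [← h₁₂, ← h₁₃, ← h₂₃, ← h] at hsum
  simp only [Fintype.sum_prod_type, Fintype.sum_bool, couplingWeight, decorationSign,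
    Bool.toNat_true, Bool.toNat_false, pow_zero, pow_one]
  linear_combination (norm := module) hsum

end OneParticle

section MatrixUnits

variable {R ι A : Type*} [CommRing R] [Fintype ι] [Ring A] [Algebra R A]

/-- The linear map `M ↦ ∑ M i j • u i j`, intended for matrix units `u i j`, for which it is
multiplicative. -/
def sumMatrixUnits (u : ι → ι → A) : Matrix ι ι R →ₗ[R] A where
  toFun M := ∑ i, ∑ j, M i j • u i j
  map_add' M N := by simp only [Matrix.add_apply, add_smul, Finset.sum_add_distrib]
  map_smul' t M := by
    simp only [Matrix.smul_apply, smul_assoc, Finset.smul_sum, RingHom.id_apply]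

theorem sumMatrixUnits_apply (u : ι → ι → A) (M : Matrix ι ι R) :
    sumMatrixUnits u M = ∑ i, ∑ j, M i j • u i j :=
  rfl

variable [DecidableEq ι] {u : ι → ι → A}
  (hu : ∀ i j k l, u i j * u k l = if j = k then u i l else 0)
include hu

theorem sumMatrixUnits_mul (M N : Matrix ι ι R) :
    sumMatrixUnits u (M * N) = sumMatrixUnits u M * sumMatrixUnits u N := by
  simp only [sumMatrixUnits_apply, Finset.sum_mul_sum, smul_mul_smul_comm, hu, smul_ite, smul_zero,
    Matrix.mul_apply, Finset.sum_smul]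
  refine Finset.sum_congr rfl fun i _ => Finset.sum_comm.trans <| Finset.sum_congr rfl fun k _ => ?_
  rw [Finset.sum_comm]
  simp

/-- The homomorphism determined by matrix units `u i j` in an algebra, which need not sum up to
`1`: the second factor `R` is mapped to the multiples of the complementary idempotent. -/
def ofMatrixUnits : Matrix ι ι R × R →ₐ[R] A :=
  AlgHom.ofLinearMap
    ((sumMatrixUnits u).coprod
      (LinearMap.toSpanSingleton R A (1 - sumMatrixUnits u (1 : Matrix ι ι R))))
    (by simp)
    (fun M N => by
      simp [add_mul, mul_add, mul_sub, sub_mul, ← sumMatrixUnits_mul hu, smul_smul, mul_comm])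

theorem ofMatrixUnits_apply_zero (M : Matrix ι ι R) :
    ofMatrixUnits hu (M, 0) = sumMatrixUnits u M := by
  simp [ofMatrixUnits]

end MatrixUnits

section FreeFermions

variable {A : Type*} [Ring A]

/-- Maassarani's relations satisfied by the hopping operators `e₁` and `e₂` of two neighbouring
links: free-fermion relations. -/
structure FreeFermions (e₁ e₂ : A) : Prop where
  left_cube : e₁ ^ 3 = e₁
  right_cube : e₂ ^ 3 = e₂
  left_sq_anticomm : e₁ ^ 2 * e₂ + e₂ * e₁ ^ 2 = e₂
  right_sq_anticomm : e₂ ^ 2 * e₁ + e₁ * e₂ ^ 2 = e₁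

/-- The projector onto the states in which the colour of the site shared by the two links differs
from the colours of both its neighbours. -/
def middleProj (e₁ e₂ : A) : A := e₁ ^ 2 * e₂ ^ 2

/-- The matrix units generated by two links: a word of hops moves the odd colour from its position
`j` to the middle site and from there to the position `i`. -/
def hopUnit (e₁ e₂ : A) (i j : Fin 3) : A :=
  ![e₁, 1, e₂] i * middleProj e₁ e₂ * ![e₁, 1, e₂] j

namespace FreeFermions

variable {e₁ e₂ : A} (H : FreeFermions e₁ e₂)
include H

theorem symm : FreeFermions e₂ e₁ :=
  ⟨H.right_cube, H.left_cube, H.right_sq_anticomm, H.left_sq_anticomm⟩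

theorem left_mul_right_mul_left : e₁ * e₂ * e₁ = 0 := by
  have h : e₁ ^ 3 * e₂ * e₁ + e₁ * e₂ * e₁ ^ 3 = e₁ * e₂ * e₁ := by
    linear_combination (norm := noncomm_ring) e₁ * H.left_sq_anticomm * e₁
  rwa [H.left_cube, add_eq_left] at h

theorem sq_commute : Commute (e₁ ^ 2) (e₂ ^ 2) := by
  have h := H.left_sq_anticomm
  rw [commute_iff_eq]
  linear_combination (norm := noncomm_ring) h * e₂ - e₂ * h

theorem isIdempotentElem_left_sq : IsIdempotentElem (e₁ ^ 2) := by
  rw [IsIdempotentElem, ← pow_add, pow_succ', H.left_cube, ← pow_two]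

theorem middleProj_symm : middleProj e₂ e₁ = middleProj e₁ e₂ :=
  H.sq_commute.eq.symm

theorem left_mul_middleProj : e₁ * middleProj e₁ e₂ = e₁ * e₂ ^ 2 := by
  rw [middleProj, ← mul_assoc, ← pow_succ', H.left_cube]

theorem middleProj_mul_left : middleProj e₁ e₂ * e₁ = e₂ ^ 2 * e₁ := by
  rw [← H.middleProj_symm, middleProj, mul_assoc, ← pow_succ, H.left_cube]

theorem middleProj_mul_middleProj :
    middleProj e₁ e₂ * middleProj e₁ e₂ = middleProj e₁ e₂ :=
  H.isIdempotentElem_left_sq.mul_of_commute H.sq_commute H.symm.isIdempotentElem_left_sq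

theorem middleProj_mul_left_mul_middleProj : middleProj e₁ e₂ * e₁ * middleProj e₁ e₂ = 0 := by
  rw [mul_assoc, H.left_mul_middleProj, ← mul_assoc, H.middleProj_mul_left]
  linear_combination (norm := noncomm_ring) e₂ * H.symm.left_mul_right_mul_left * e₂

theorem middleProj_mul_left_mul_left_mul_middleProj :
    middleProj e₁ e₂ * e₁ * e₁ * middleProj e₁ e₂ = middleProj e₁ e₂ := by
  rw [mul_assoc, mul_assoc, ← mul_assoc e₁, ← pow_two, ← mul_assoc]
  nth_rw 1 [← H.middleProj_symm]
  rw [middleProj, mul_assoc (e₂ ^ 2), H.isIdempotentElem_left_sq, ← middleProj,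
    H.middleProj_symm, H.middleProj_mul_middleProj]

theorem middleProj_mul_left_mul_right_mul_middleProj :
    middleProj e₁ e₂ * e₁ * e₂ * middleProj e₁ e₂ = 0 := by
  rw [mul_assoc, ← H.middleProj_symm, H.symm.left_mul_middleProj, H.middleProj_symm,
    H.middleProj_mul_left]
  linear_combination (norm := noncomm_ring) e₂ ^ 2 * H.left_mul_right_mul_left * e₁

theorem middleProj_mul_hop_mul_hop_mul_middleProj (j k : Fin 3) :
    middleProj e₁ e₂ * ![e₁, 1, e₂] j * ![e₁, 1, e₂] k * middleProj e₁ e₂ =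
      if j = k then middleProj e₁ e₂ else 0 := by
  have hs := H.symm.middleProj_mul_left_mul_middleProj
  have hss := H.symm.middleProj_mul_left_mul_left_mul_middleProj
  have hsl := H.symm.middleProj_mul_left_mul_right_mul_middleProj
  rw [H.middleProj_symm] at hs hss hsl
  fin_cases j <;> fin_cases k <;>
    simp [H.middleProj_mul_middleProj, H.middleProj_mul_left_mul_middleProj,
      H.middleProj_mul_left_mul_left_mul_middleProj,
      H.middleProj_mul_left_mul_right_mul_middleProj, hs, hss, hsl]

theorem hopUnit_mul_hopUnit (i j k l : Fin 3) :
    hopUnit e₁ e₂ i j * hopUnit e₁ e₂ k l = if j = k then hopUnit e₁ e₂ i l else 0 := by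
  calc hopUnit e₁ e₂ i j * hopUnit e₁ e₂ k l
      = ![e₁, 1, e₂] i * (middleProj e₁ e₂ * ![e₁, 1, e₂] j * ![e₁, 1, e₂] k * middleProj e₁ e₂) *
          ![e₁, 1, e₂] l := by simp only [hopUnit, mul_assoc]
    _ = _ := by
      rw [H.middleProj_mul_hop_mul_hop_mul_middleProj]
      split <;> simp [hopUnit]

theorem left_mul_middleProj_add_middleProj_mul_left :
    e₁ * middleProj e₁ e₂ + middleProj e₁ e₂ * e₁ = e₁ := by
  rw [H.left_mul_middleProj, H.middleProj_mul_left, add_comm, H.right_sq_anticomm]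

variable [Algebra ℂ A]

/-- The representation of the one-particle model in an algebra with two free-fermion links; the
summand `ℂ` is what makes it unital. -/
def ofOneParticle : OneParticle →ₐ[ℂ] A :=
  ofMatrixUnits H.hopUnit_mul_hopUnit

theorem ofOneParticle_apply (M : Matrix (Fin 3) (Fin 3) ℂ) :
    H.ofOneParticle (M, 0) = ∑ i, ∑ j, M i j • hopUnit e₁ e₂ i j := by
  rw [ofOneParticle, ofMatrixUnits_apply_zero, sumMatrixUnits_apply]

theorem ofOneParticle_hopLeft : H.ofOneParticle OneParticle.hopLeft = e₁ := by
  rw [OneParticle.hopLeft, ofOneParticle_apply]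
  simpa [Fin.sum_univ_three, hopUnit, add_comm] using
    H.left_mul_middleProj_add_middleProj_mul_left

theorem ofOneParticle_hopRight : H.ofOneParticle OneParticle.hopRight = e₂ := by
  rw [OneParticle.hopRight, ofOneParticle_apply]
  simpa [Fin.sum_univ_three, hopUnit, add_comm, H.middleProj_symm] using
    H.symm.left_mul_middleProj_add_middleProj_mul_left

end FreeFermions

end FreeFermions

section FreeFermionsWithParity

/-- Hopping operators `e₁`, `e₂` of two neighbouring links that conserve a parity operator `κ`. -/
structure FreeFermionsWithParity {A : Type*} [Ring A] (e₁ e₂ κ : A) : Prop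
    extends FreeFermions e₁ e₂ where
  parity_sq : κ ^ 2 = 1
  parity_left : Commute κ e₁
  parity_right : Commute κ e₂

namespace FreeFermionsWithParity

open OneParticle

variable {A : Type*} [Ring A] [Algebra ℂ A] {e₁ e₂ κ : A} (H : FreeFermionsWithParity e₁ e₂ κ)
include H

theorem decorationSign_smul_pow_mul (i : Bool × Bool × Bool) (a : A) :
    decorationSign i • (κ ^ decorationCount i * a) = decorationSign i • (κ * a) := by
  have hκ : κ ^ 3 = κ := by rw [pow_succ, H.parity_sq, one_mul]
  rcases i with ⟨_ | _, _ | _, _ | _⟩ <;> simp [decorationSign, decorationCount, hκ]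

theorem leftTriple_eq (x y z : ℂ) (i : Bool × Bool × Bool) :
    leftTriple e₁ e₂ κ x y z i =
      rightTriple e₁ e₂ κ x y z i +
        decorationSign i • (κ * H.ofOneParticle (defect x y z)) := by
  have h := congrArg H.ofOneParticle (OneParticle.leftTriple_eq x y z i)
  rw [map_add, map_smul, map_leftTriple, map_rightTriple, map_one, H.ofOneParticle_hopLeft,
    H.ofOneParticle_hopRight] at h
  rw [leftTriple_eq_pow_mul H.parity_left H.parity_right, h, mul_add, mul_smul_comm,
    ← rightTriple_eq_pow_mul H.parity_left H.parity_right, H.decorationSign_smul_pow_mul]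

theorem weighted_sum_tripleSum {x y z k₁₂ k₁₃ k₂₃ : ℂ} (hk : HubbardCouplings x y z k₁₂ k₁₃ k₂₃) :
    ∑ i, (couplingWeight k₁₂ k₁₃ k₂₃ i * decorationSign i) • tripleSum e₁ e₂ κ x y z i = 0 := by
  have h := congrArg (κ * H.ofOneParticle ·) (OneParticle.weighted_sum_tripleSum hk)
  simp only [map_sum, map_smul, map_tripleSum, map_one, H.ofOneParticle_hopLeft,
    H.ofOneParticle_hopRight, map_zero, mul_zero, Finset.mul_sum, mul_smul_comm] at h
  simpa only [mul_smul, tripleSum_eq_pow_mul H.parity_left H.parity_right (κ := κ),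
    H.decorationSign_smul_pow_mul] using h

end FreeFermionsWithParity

end FreeFermionsWithParity

section BraidYangBaxter

theorem sum_smul_bilinear_eq {𝕜 ι L M N : Type*} [Field 𝕜] [CharZero 𝕜] [Fintype ι]
    [AddCommGroup L] [Module 𝕜 L] [AddCommGroup M] [Module 𝕜 M] [AddCommGroup N] [Module 𝕜 N]
    (f : L →ₗ[𝕜] M →ₗ[𝕜] N) {c ε : ι → 𝕜} {T S : ι → L} {T' S' : ι → M} {D : L} {D' : M}
    (hT : ∀ i, T i = S i + ε i • D) (hT' : ∀ i, T' i = S' i + ε i • D')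
    (hsum : ∑ i, (c i * ε i) • (T i + S i) = 0)
    (hsum' : ∑ i, (c i * ε i) • (T' i + S' i) = 0) :
    ∑ i, c i • f (T i) (T' i) = ∑ i, c i • f (S i) (S' i) := by
  have hterm (i : ι) : c i • f (T i) (T' i) = c i • f (S i) (S' i) +
      (1 / 2 : 𝕜) • (f ((c i * ε i) • (T i + S i)) D' + f D ((c i * ε i) • (T' i + S' i))) := by
    rw [hT, hT']
    simp only [map_add, map_smul, LinearMap.add_apply, LinearMap.smul_apply]
    module
  simp only [hterm, Finset.sum_add_distrib, ← Finset.smul_sum, ← LinearMap.sum_apply, ← map_sum,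
    hsum, hsum', map_zero, LinearMap.zero_apply, add_zero, smul_zero]

variable {A B : Type*} [Ring A] [Algebra ℂ A] [Ring B] [Algebra ℂ B]

theorem FreeFermionsWithParity.hubbardBraid_yangBaxter {e₁ e₂ κ : A} {e₁' e₂' κ' : B}
    (H : FreeFermionsWithParity e₁ e₂ κ) (H' : FreeFermionsWithParity e₁' e₂' κ')
    {x y z k₁₂ k₁₃ k₂₃ : ℂ} (hk : HubbardCouplings x y z k₁₂ k₁₃ k₂₃) :
    hubbardBraid k₁₂ e₂ (parityMiddle e₁ e₂ κ) e₂' (parityMiddle e₁' e₂' κ') x y *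
          hubbardBraid k₁₃ e₁ (parityLeft e₂ κ) e₁' (parityLeft e₂' κ') x z *
        hubbardBraid k₂₃ e₂ (parityMiddle e₁ e₂ κ) e₂' (parityMiddle e₁' e₂' κ') y z =
      hubbardBraid k₂₃ e₁ (parityLeft e₂ κ) e₁' (parityLeft e₂' κ') y z *
          hubbardBraid k₁₃ e₂ (parityMiddle e₁ e₂ κ) e₂' (parityMiddle e₁' e₂' κ') x z *
        hubbardBraid k₁₂ e₁ (parityLeft e₂ κ) e₁' (parityLeft e₂' κ') x y := by
  have h := sum_smul_bilinear_eq (TensorProduct.mk ℂ A B) (H.leftTriple_eq x y z)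
    (H'.leftTriple_eq x y z) (H.weighted_sum_tripleSum hk) (H'.weighted_sum_tripleSum hk)
  simp only [Fintype.sum_prod_type, Fintype.sum_bool, couplingWeight, TensorProduct.mk_apply,
    leftTriple, rightTriple, ← Algebra.TensorProduct.tmul_mul_tmul] at h
  simp only [hubbardBraid, Fintype.sum_bool, add_mul, mul_add, smul_mul_assoc, mul_smul_comm]
  linear_combination (norm := module) h

end BraidYangBaxter

section Sites

/-- Two sites with parity operators `c₁` and `c₂`, which the permutation `p` exchanges. -/
structure TwoSites {M : Type*} [Monoid M] (p c₁ c₂ : M) : Prop where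
  swap_sq : p * p = 1
  swap_left : SemiconjBy p c₁ c₂
  comm : Commute c₁ c₂
  left_sq : c₁ * c₁ = 1
  right_sq : c₂ * c₂ = 1

namespace TwoSites

variable {M : Type*} [Monoid M] {p c₁ c₂ : M} (H : TwoSites p c₁ c₂)
include H

theorem map {N F : Type*} [Monoid N] [FunLike F M N] [MonoidHomClass F M N] (f : F) :
    TwoSites (f p) (f c₁) (f c₂) where
  swap_sq := by rw [← map_mul, H.swap_sq, map_one]
  swap_left := H.swap_left.map f
  comm := H.comm.map f
  left_sq := by rw [← map_mul, H.left_sq, map_one]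
  right_sq := by rw [← map_mul, H.right_sq, map_one]

theorem swap_right : SemiconjBy p c₂ c₁ := by
  have h := congrArg (p * · * p) H.swap_left.eq
  simp only [mul_assoc, H.swap_sq, mul_one] at h
  rwa [← mul_assoc, H.swap_sq, one_mul, eq_comm] at h

theorem symm : TwoSites p c₂ c₁ :=
  ⟨H.swap_sq, H.swap_right, H.comm.symm, H.right_sq, H.left_sq⟩

theorem mul_mul_mul_self : c₁ * c₂ * (c₁ * c₂) = 1 := by
  rw [H.comm.symm.mul_mul_mul_comm, H.left_sq, H.right_sq, one_mul]

end TwoSites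

/-- Three sites with parity operators `c₁`, `c₂`, `c₃`; the permutations `p` of the first two and
`q` of the last two satisfy the braid relation. -/
structure ThreeSites {M : Type*} [Monoid M] (p q c₁ c₂ c₃ : M) : Prop where
  left : TwoSites p c₁ c₂
  right : TwoSites q c₂ c₃
  swap_right : Commute p c₃
  swap_left : Commute q c₁
  comm : Commute c₁ c₃
  braid : p * q * p = q * p * q

namespace ThreeSites

variable {M : Type*} [Monoid M] {p q c₁ c₂ c₃ : M} (H : ThreeSites p q c₁ c₂ c₃)
include H

theorem semiconjBy_middle_left : SemiconjBy (q * p) c₂ c₁ :=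
  SemiconjBy.mul_left H.swap_left H.left.swap_right

theorem semiconjBy_right_middle : SemiconjBy (q * p) c₃ c₂ :=
  SemiconjBy.mul_left H.right.swap_right H.swap_right

end ThreeSites

theorem yangBaxter_of_braid {M : Type*} [Monoid M] {p q r₁ r₁' r₁'' r₂ r₂' r₂'' : M}
    (hp : p * p = 1) (hq : q * q = 1) (hpq : p * q * p = q * p * q)
    (h : SemiconjBy (q * p) r₂ r₁) (h' : SemiconjBy (q * p) r₂' r₁')
    (h'' : SemiconjBy (q * p) r₂'' r₁'') (hbraid : r₂ * r₁' * r₂'' = r₁'' * r₂' * r₁) :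
    p * r₁ * (q * (p * r₁') * q) * (q * r₂'') = q * r₂'' * (q * (p * r₁') * q) * (p * r₁) := by
  have hinv : p * q * (q * p) = 1 := by rw [mul_assoc, ← mul_assoc q, hq, one_mul, hp]
  have hinv' : q * p * (p * q) = 1 := by rw [mul_assoc, ← mul_assoc p, hp, one_mul, hq]
  have hr'' : p * q * r₁'' = r₂'' * (p * q) :=
    (SemiconjBy.units_inv_symm_left (a := ⟨q * p, p * q, hinv', hinv⟩) h'').eq
  calc p * r₁ * (q * (p * r₁') * q) * (q * r₂'')
      = p * (r₁ * (q * p)) * r₁' * (q * q) * r₂'' := by simp only [mul_assoc]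
    _ = p * q * p * (r₂ * r₁' * r₂'') := by rw [← h.eq, hq]; simp only [mul_assoc, one_mul]
    _ = q * (p * q * r₁'') * r₂' * r₁ := by rw [hbraid, hpq]; simp only [mul_assoc]
    _ = q * r₂'' * (p * q * p * p) * r₂' * r₁ := by
      rw [hr'', mul_assoc (p * q), hp]; simp only [mul_assoc, one_mul]
    _ = q * r₂'' * q * p * (q * p * r₂') * r₁ := by rw [hpq]; simp only [mul_assoc]
    _ = q * r₂'' * (q * (p * r₁') * q) * (p * r₁) := by rw [h'.eq]; simp only [mul_assoc]

end Sites

section Hopping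

variable {A B : Type*} [Ring A] [Algebra ℂ A] [Ring B] [Algebra ℂ B]

/-- The projector `Σ₁₂` onto the states of two sites in which their parities `c₁`, `c₂` differ. -/
def distinctProj (c₁ c₂ : A) : A := (1 / 2 : ℂ) • (1 - c₁ * c₂)

/-- The hopping operator `P₁₂ Σ₁₂`. -/
def hop (p c₁ c₂ : A) : A := p * distinctProj c₁ c₂

theorem map_hop (f : A →ₐ[ℂ] B) (p c₁ c₂ : A) : f (hop p c₁ c₂) = hop (f p) (f c₁) (f c₂) := by
  simp only [hop, distinctProj, map_mul, map_smul, map_sub, map_one]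

theorem semiconjBy_distinctProj {g c₁ c₂ d₁ d₂ : A} (h₁ : SemiconjBy g c₁ d₁)
    (h₂ : SemiconjBy g c₂ d₂) : SemiconjBy g (distinctProj c₁ c₂) (distinctProj d₁ d₂) :=
  ((SemiconjBy.one_right g).sub_right (h₁.mul_right h₂)).smul_right _

theorem distinctProj_symm {c₁ c₂ : A} (h : Commute c₁ c₂) :
    distinctProj c₂ c₁ = distinctProj c₁ c₂ := by
  rw [distinctProj, distinctProj, h.eq]

theorem one_sub_two_mul_distinctProj (c₁ c₂ : A) : 1 - 2 * distinctProj c₁ c₂ = c₁ * c₂ := by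
  rw [distinctProj, two_mul]
  module

theorem distinctProj_mul_add_mul_distinctProj {c₁ c₂ e : A} (h : SemiconjBy (c₁ * c₂) e (-e)) :
    distinctProj c₁ c₂ * e + e * distinctProj c₁ c₂ = e := by
  simp only [distinctProj, smul_mul_assoc, mul_smul_comm, sub_mul, mul_sub, h.eq, neg_mul,
    one_mul, mul_one]
  module

namespace TwoSites

variable {p c₁ c₂ : A} (H : TwoSites p c₁ c₂)
include H

theorem commute_swap_distinctProj : Commute p (distinctProj c₁ c₂) := by
  have h := semiconjBy_distinctProj H.swap_left H.swap_right
  rwa [distinctProj_symm H.comm] at h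

theorem distinctProj_mul_self : distinctProj c₁ c₂ * distinctProj c₁ c₂ = distinctProj c₁ c₂ := by
  simp only [distinctProj, smul_mul_smul_comm, mul_sub, sub_mul, one_mul, mul_one,
    H.mul_mul_mul_self]
  module

theorem hop_sq : hop p c₁ c₂ ^ 2 = distinctProj c₁ c₂ := by
  rw [hop, H.commute_swap_distinctProj.mul_pow, pow_two, pow_two, H.swap_sq, one_mul,
    H.distinctProj_mul_self]

theorem hop_cube : hop p c₁ c₂ ^ 3 = hop p c₁ c₂ := by
  rw [pow_succ', H.hop_sq, hop, mul_assoc, H.distinctProj_mul_self]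

theorem one_sub_two_mul_hop_sq : 1 - 2 * hop p c₁ c₂ ^ 2 = c₁ * c₂ := by
  rw [H.hop_sq, one_sub_two_mul_distinctProj]

theorem left_anticomm_hop : SemiconjBy c₁ (hop p c₁ c₂) (-hop p c₁ c₂) := by
  have h : c₂ * distinctProj c₁ c₂ = -(distinctProj c₁ c₂ * c₁) := by
    have h₁ : c₁ * c₂ * c₁ = c₂ := by rw [H.comm.eq, mul_assoc, H.left_sq, mul_one]
    have h₂ : c₂ * (c₁ * c₂) = c₁ := by rw [H.comm.eq, ← mul_assoc, H.right_sq, one_mul]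
    simp only [distinctProj, smul_mul_assoc, mul_smul_comm, mul_sub, sub_mul, one_mul, mul_one,
      h₁, h₂]
    module
  rw [SemiconjBy, hop, ← mul_assoc, ← H.swap_right.eq, mul_assoc, h, mul_neg, neg_mul, mul_assoc]

theorem right_anticomm_hop : SemiconjBy c₂ (hop p c₁ c₂) (-hop p c₁ c₂) := by
  have h := H.symm.left_anticomm_hop
  rwa [hop, distinctProj_symm H.comm] at h

theorem commute_mul_hop : Commute (c₁ * c₂) (hop p c₁ c₂) := by
  have h := H.left_anticomm_hop.neg_right.mul_left H.right_anticomm_hop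
  rw [neg_neg] at h
  exact h

end TwoSites

namespace ThreeSites

variable {p q c₁ c₂ c₃ : A} (H : ThreeSites p q c₁ c₂ c₃)
include H

theorem commute_right_hop : Commute c₃ (hop p c₁ c₂) :=
  H.swap_right.symm.mul_right
    (semiconjBy_distinctProj H.comm.symm H.right.comm.symm)

theorem commute_left_hop : Commute c₁ (hop q c₂ c₃) :=
  H.swap_left.symm.mul_right (semiconjBy_distinctProj H.left.comm H.comm)

theorem freeFermions : FreeFermions (hop p c₁ c₂) (hop q c₂ c₃) where
  left_cube := H.left.hop_cube
  right_cube := H.right.hop_cube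
  left_sq_anticomm := by
    rw [H.left.hop_sq]
    exact distinctProj_mul_add_mul_distinctProj
      (SemiconjBy.mul_left H.commute_left_hop.neg_right H.right.left_anticomm_hop)
  right_sq_anticomm := by
    rw [H.right.hop_sq]
    exact distinctProj_mul_add_mul_distinctProj
      (SemiconjBy.mul_left H.left.right_anticomm_hop H.commute_right_hop)

theorem freeFermionsWithParity :
    FreeFermionsWithParity (hop p c₁ c₂) (hop q c₂ c₃) (c₁ * c₂ * c₃) where
  toFreeFermions := H.freeFermions
  parity_sq := by
    rw [(H.comm.mul_left H.right.comm).mul_pow, H.left.comm.mul_pow, pow_two, pow_two, pow_two,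
      H.left.left_sq, H.left.right_sq, H.right.right_sq, one_mul, one_mul]
  parity_left := H.left.commute_mul_hop.mul_left H.commute_right_hop
  parity_right := by
    rw [mul_assoc]
    exact H.commute_left_hop.mul_left H.right.commute_mul_hop

theorem parityLeft_eq : parityLeft (hop q c₂ c₃) (c₁ * c₂ * c₃) = c₁ := by
  rw [parityLeft, H.right.one_sub_two_mul_hop_sq, mul_assoc c₁, mul_assoc c₁,
    H.right.mul_mul_mul_self, mul_one]

theorem parityMiddle_eq :
    parityMiddle (hop p c₁ c₂) (hop q c₂ c₃) (c₁ * c₂ * c₃) = c₂ := by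
  have h := H.parityLeft_eq
  rw [parityLeft] at h
  have hc : Commute (1 - 2 * hop p c₁ c₂ ^ 2) (1 - 2 * hop q c₂ c₃ ^ 2) := by
    rw [H.left.one_sub_two_mul_hop_sq, H.right.one_sub_two_mul_hop_sq]
    exact (H.left.comm.mul_right H.comm).mul_left
      ((Commute.refl c₂).mul_right H.right.comm)
  rw [parityMiddle, hc.eq, ← mul_assoc, h, H.left.one_sub_two_mul_hop_sq, ← mul_assoc,
    H.left.left_sq, one_mul]

theorem semiconjBy_hop : SemiconjBy (q * p) (hop q c₂ c₃) (hop p c₁ c₂) :=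
  SemiconjBy.mul_right (by rw [SemiconjBy, ← mul_assoc, ← H.braid])
    (semiconjBy_distinctProj H.semiconjBy_middle_left H.semiconjBy_right_middle)

end ThreeSites

theorem ThreeSites.hubbard_yangBaxter {p q c₁ c₂ c₃ : A} {p' q' c₁' c₂' c₃' : B}
    (H : ThreeSites p q c₁ c₂ c₃) (H' : ThreeSites p' q' c₁' c₂' c₃')
    {x y z k₁₂ k₁₃ k₂₃ : ℂ} (hk : HubbardCouplings x y z k₁₂ k₁₃ k₂₃) :
    p ⊗ₜ[ℂ] p' * hubbardBraid k₁₂ (hop p c₁ c₂) c₁ (hop p' c₁' c₂') c₁' x y *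
          (q ⊗ₜ q' * (p ⊗ₜ p' * hubbardBraid k₁₃ (hop p c₁ c₂) c₁ (hop p' c₁' c₂') c₁' x z) *
            q ⊗ₜ q') *
        (q ⊗ₜ q' * hubbardBraid k₂₃ (hop q c₂ c₃) c₂ (hop q' c₂' c₃') c₂' y z) =
      q ⊗ₜ q' * hubbardBraid k₂₃ (hop q c₂ c₃) c₂ (hop q' c₂' c₃') c₂' y z *
          (q ⊗ₜ q' * (p ⊗ₜ p' * hubbardBraid k₁₃ (hop p c₁ c₂) c₁ (hop p' c₁' c₂') c₁' x z) *
            q ⊗ₜ q') *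
        (p ⊗ₜ p' * hubbardBraid k₁₂ (hop p c₁ c₂) c₁ (hop p' c₁' c₂') c₁' x y) := by
  have hconj (k x y : ℂ) := semiconjBy_hubbardBraid H.semiconjBy_hop H.semiconjBy_middle_left
    H'.semiconjBy_hop H'.semiconjBy_middle_left k x y
  have hbraid := H.freeFermionsWithParity.hubbardBraid_yangBaxter H'.freeFermionsWithParity hk
  simp only [H.parityLeft_eq, H'.parityLeft_eq, H.parityMiddle_eq, H'.parityMiddle_eq] at hbraid
  simp only [← Algebra.TensorProduct.tmul_mul_tmul] at hconj
  refine yangBaxter_of_braid ?_ ?_ ?_ (hconj _ _ _) (hconj _ _ _) (hconj _ _ _) hbraid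
  · rw [Algebra.TensorProduct.tmul_mul_tmul, H.left.swap_sq, H'.left.swap_sq,
      Algebra.TensorProduct.one_def]
  · rw [Algebra.TensorProduct.tmul_mul_tmul, H.right.swap_sq, H'.right.swap_sq,
      Algebra.TensorProduct.one_def]
  · simp only [Algebra.TensorProduct.tmul_mul_tmul, H.braid, H'.braid]

end Hopping

section CouplingIdentities

open Complex

theorem coupling_swap (h : ℂ → ℂ) (x y : ℂ) : coupling h y x = -coupling h x y := by
  rw [coupling, coupling, ← neg_sub x y, sin_neg, add_comm y, add_comm (h y)]
  ring

variable {U : ℂ} {h : ℂ → ℂ} (hh : ∀ l : ℂ, sinh (2 * h l) = U * sin (2 * l))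
include hh

theorem sinh_add_mul_cosh_sub (x y : ℂ) :
    sinh (h x + h y) * cosh (h x - h y) = U * (sin (x + y) * cos (x - y)) := by
  have hx := hh x
  have hy := hh y
  rw [sinh_two_mul, sin_two_mul] at hx hy
  rw [sinh_add, cosh_sub, sin_add, cos_sub]
  linear_combination hx / 2 + hy / 2 + cosh (h x) * sinh (h x) * cosh_sq_sub_sinh_sq (h y) +
    cosh (h y) * sinh (h y) * cosh_sq_sub_sinh_sq (h x) -
    U * sin x * cos x * sin_sq_add_cos_sq y - U * sin y * cos y * sin_sq_add_cos_sq x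

theorem sinh_sub_mul_cosh_add (x y : ℂ) :
    sinh (h x - h y) * cosh (h x + h y) = U * (sin (x - y) * cos (x + y)) := by
  have hx := hh x
  have hy := hh y
  rw [sinh_two_mul, sin_two_mul] at hx hy
  rw [sinh_sub, cosh_add, sin_sub, cos_add]
  linear_combination hx / 2 - hy / 2 + cosh (h x) * sinh (h x) * cosh_sq_sub_sinh_sq (h y) -
    cosh (h y) * sinh (h y) * cosh_sq_sub_sinh_sq (h x) -
    U * sin x * cos x * sin_sq_add_cos_sq y + U * sin y * cos y * sin_sq_add_cos_sq x

theorem hubbardCouplings_coupling {x y z : ℂ} (hxy : sin (x + y) ≠ 0) (hxz : sin (x + z) ≠ 0)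
    (hyz : sin (y + z) ≠ 0) (hxy' : cosh (h x + h y) ≠ 0) (hxz' : cosh (h x + h z) ≠ 0)
    (hyz' : cosh (h y + h z) ≠ 0) :
    HubbardCouplings x y z (coupling h x y) (coupling h x z) (coupling h y z) := by
  have h₁₂ := sinh_add_mul_cosh_sub hh x y
  have h₁₃ := sinh_add_mul_cosh_sub hh x z
  have h₂₃ := sinh_add_mul_cosh_sub hh y z
  rw [show h x - h y = (h x + h z) - (h y + h z) by ring, cosh_sub] at h₁₂
  rw [show h x - h z = (h x + h y) - (h y + h z) by ring, cosh_sub] at h₁₃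
  rw [show h y - h z = (h x + h y) - (h x + h z) by ring, cosh_sub] at h₂₃
  refine ⟨U / (cosh (h x + h y) * cosh (h x + h z) * cosh (h y + h z)),
    tanh (h x + h y) * tanh (h x + h z) * tanh (h y + h z) /
      (sin (x + y) * sin (x + z) * sin (y + z)), ?_, ?_, ?_, ?_⟩ <;>
    simp only [coupling, tanh_eq_sinh_div_cosh] <;> field_simp
  · linear_combination sin (x - y) * h₁₂
  · linear_combination sin (x - z) * h₁₃
  · linear_combination sin (y - z) * h₂₃

theorem coupling_mul_cos {x y : ℂ} (hs : sin (x + y) ≠ 0) (hc : cosh (h x + h y) ≠ 0)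
    (hc' : cosh (h x - h y) ≠ 0) :
    coupling h x y * cos (x + y) = tanh (h x - h y) * cos (x - y) := by
  have hadd := sinh_add_mul_cosh_sub hh x y
  have hsub := sinh_sub_mul_cosh_add hh x y
  rw [coupling, tanh_eq_sinh_div_cosh, tanh_eq_sinh_div_cosh]
  field_simp
  linear_combination sin (x - y) * cos (x + y) * hadd - sin (x + y) * cos (x - y) * hsub

end CouplingIdentities

section Legs

variable {V : Type*} [AddCommGroup V] [Module ℂ V]

theorem op1_mul_op1 (X Y : Module.End ℂ V) : op1 X * op1 Y = op1 (X * Y) :=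
  (TensorProduct.map_mul X Y 1 1).symm

theorem op2_mul_op2 (X Y : Module.End ℂ V) : op2 X * op2 Y = op2 (X * Y) :=
  (TensorProduct.map_mul 1 1 X Y).symm

theorem commute_op1_op2 (X Y : Module.End ℂ V) : Commute (op1 X) (op2 Y) := by
  ext; simp [op1, op2]

theorem op1_one : op1 (1 : Module.End ℂ V) = 1 :=
  TensorProduct.map_one

theorem op2_one : op2 (1 : Module.End ℂ V) = 1 :=
  TensorProduct.map_one

variable (V) in
/-- `leg12` as an algebra homomorphism. -/
def leg12Hom : Module.End ℂ (V ⊗[ℂ] V) →ₐ[ℂ] Module.End ℂ (V ⊗[ℂ] V ⊗[ℂ] V) :=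
  AlgHom.ofLinearMap (LinearMap.rTensorHom V) (LinearMap.rTensor_id V _)
    (fun X Y => LinearMap.rTensor_mul V X Y)

variable (V) in
/-- `leg23` as an algebra homomorphism. -/
def leg23Hom : Module.End ℂ (V ⊗[ℂ] V) →ₐ[ℂ] Module.End ℂ (V ⊗[ℂ] V ⊗[ℂ] V) :=
  AlgHom.ofLinearMap
    ((TensorProduct.assoc ℂ V V V).symm.conj.toLinearMap ∘ₗ LinearMap.lTensorHom V)
    (by ext; simp [LinearEquiv.conj_apply])
    (fun X Y => by ext; simp [LinearEquiv.conj_apply])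

theorem leg12Hom_tmul (X : Module.End ℂ (V ⊗[ℂ] V)) (t : V ⊗[ℂ] V) (w : V) :
    leg12Hom V X (t ⊗ₜ w) = X t ⊗ₜ w :=
  rfl

theorem leg23Hom_tmul (X : Module.End ℂ (V ⊗[ℂ] V)) (u v w : V) :
    leg23Hom V X (u ⊗ₜ v ⊗ₜ w) = (TensorProduct.assoc ℂ V V V).symm (u ⊗ₜ X (v ⊗ₜ w)) :=
  rfl

theorem leg23Hom_op1 (X : Module.End ℂ V) : leg23Hom V (op1 X) = leg12Hom V (op2 X) := by
  ext; simp [leg23Hom_tmul, leg12Hom_tmul, op1, op2]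

theorem commute_leg12Hom_op1 (X : Module.End ℂ V) (Y : Module.End ℂ (V ⊗[ℂ] V)) :
    Commute (leg12Hom V (op1 X)) (leg23Hom V Y) := by
  ext u v w
  simp only [TensorProduct.AlgebraTensorModule.curry_apply, LinearMap.restrictScalars_self,
    TensorProduct.curry_apply, Module.End.mul_apply, leg12Hom_tmul, leg23Hom_tmul, op1,
    TensorProduct.map_tmul, Module.End.one_apply]
  induction Y (v ⊗ₜ w) with
  | zero => simp
  | tmul s t => simp [leg12Hom_tmul]
  | add s t hs ht => simp only [TensorProduct.tmul_add, map_add, hs, ht]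

theorem commute_leg12Hom_leg23Hom_op2 (X : Module.End ℂ V) (Y : Module.End ℂ (V ⊗[ℂ] V)) :
    Commute (leg12Hom V Y) (leg23Hom V (op2 X)) := by
  ext u v w
  simp only [TensorProduct.AlgebraTensorModule.curry_apply, LinearMap.restrictScalars_self,
    TensorProduct.curry_apply, Module.End.mul_apply, leg12Hom_tmul, leg23Hom_tmul, op2,
    TensorProduct.map_tmul, Module.End.one_apply, TensorProduct.assoc_symm_tmul]
  induction Y (u ⊗ₜ v) with
  | zero => simp
  | tmul s t => simp [leg23Hom_tmul]
  | add s t hs ht => simp only [TensorProduct.add_tmul, map_add, ← hs, ← ht]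

end Legs

theorem linearMap_ext_homogeneous {R ι M N : Type*} [CommRing R] [DecidableEq ι] [AddCommGroup M]
    [Module R M] [AddCommGroup N] [Module R N] (ℳ : ι → Submodule R M)
    [DirectSum.Decomposition ℳ] {f g : M →ₗ[R] N} (h : ∀ i, ∀ m ∈ ℳ i, f m = g m) : f = g := by
  ext m
  induction m using DirectSum.Decomposition.inductionOn ℳ with
  | zero => simp
  | homogeneous m => exact h _ m m.2
  | add m n hm hn => rw [map_add, map_add, hm, hn]

section GradedPermutation

variable {V : Type*} [AddCommGroup V] [Module ℂ V] (𝒱 : ZMod 2 → Submodule ℂ V)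
  [DirectSum.Decomposition 𝒱]

theorem P_mul_P : P 𝒱 * P 𝒱 = 1 := by
  refine TensorProduct.ext (linearMap_ext_homogeneous 𝒱 fun i u hu =>
    linearMap_ext_homogeneous 𝒱 fun j v hv => ?_)
  simp only [LinearMap.compr₂ₛₗ_apply, TensorProduct.mk_apply, Module.End.mul_apply,
    P_tmul 𝒱 hu hv, map_smul, P_tmul 𝒱 hv hu, smul_smul, Module.End.one_apply]
  rw [mul_comm j.val, ← pow_add, Even.neg_one_pow ⟨_, rfl⟩, one_smul]

theorem semiconjBy_P_op1_op2 {X : Module.End ℂ V} (hX : ∀ i, ∀ v ∈ 𝒱 i, X v ∈ 𝒱 i) :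
    SemiconjBy (P 𝒱) (op1 X) (op2 X) := by
  refine TensorProduct.ext (linearMap_ext_homogeneous 𝒱 fun i u hu =>
    linearMap_ext_homogeneous 𝒱 fun j v hv => ?_)
  simp only [LinearMap.compr₂ₛₗ_apply, TensorProduct.mk_apply, Module.End.mul_apply, op1, op2,
    TensorProduct.map_tmul, Module.End.one_apply, P_tmul 𝒱 hu hv, map_smul,
    P_tmul 𝒱 (hX i u hu) hv]

theorem P_braid :
    leg12Hom V (P 𝒱) * leg23Hom V (P 𝒱) * leg12Hom V (P 𝒱) =
      leg23Hom V (P 𝒱) * leg12Hom V (P 𝒱) * leg23Hom V (P 𝒱) := by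
  refine TensorProduct.ext (TensorProduct.ext (linearMap_ext_homogeneous 𝒱 fun i u hu =>
    linearMap_ext_homogeneous 𝒱 fun j v hv => linearMap_ext_homogeneous 𝒱 fun k w hw => ?_))
  simp only [LinearMap.compr₂ₛₗ_apply, TensorProduct.mk_apply, Module.End.mul_apply,
    leg12Hom_tmul, leg23Hom_tmul, P_tmul 𝒱 hu hv, P_tmul 𝒱 hu hw, P_tmul 𝒱 hv hw,
    ← TensorProduct.smul_tmul', TensorProduct.tmul_smul, map_smul, TensorProduct.assoc_symm_tmul,
    smul_smul]
  ring_nf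

theorem Sig_eq_distinctProj (π : Module.End ℂ V) :
    Sig π = distinctProj (op1 (C π)) (op2 (C π)) := by
  refine TensorProduct.ext' fun u v => ?_
  simp only [Sig, C, distinctProj, op1, op2, LinearMap.add_apply, LinearMap.sub_apply,
    LinearMap.smul_apply, Module.End.mul_apply, TensorProduct.map_tmul, Module.End.one_apply,
    TensorProduct.sub_tmul, TensorProduct.tmul_sub, map_sub]
  module

theorem C_mul_C {π : Module.End ℂ V} (hπ : IsIdempotentElem π) : C π * C π = 1 := by
  rw [C]
  linear_combination (norm := noncomm_ring) 4 * hπ.eq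

variable {π : Module.End ℂ V} (hπ : IsIdempotentElem π) (heven : ∀ i, ∀ v ∈ 𝒱 i, π v ∈ 𝒱 i)
include hπ heven

theorem twoSites : TwoSites (P 𝒱) (op1 (C π)) (op2 (C π)) where
  swap_sq := P_mul_P 𝒱
  swap_left := semiconjBy_P_op1_op2 𝒱 fun i v hv =>
    sub_mem (heven i v hv) (sub_mem hv (heven i v hv))
  comm := commute_op1_op2 _ _
  left_sq := by rw [op1_mul_op1, C_mul_C hπ, op1_one]
  right_sq := by rw [op2_mul_op2, C_mul_C hπ, op2_one]

theorem threeSites :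
    ThreeSites (leg12Hom V (P 𝒱)) (leg23Hom V (P 𝒱)) (leg12Hom V (op1 (C π)))
      (leg23Hom V (op1 (C π))) (leg23Hom V (op2 (C π))) where
  left := by
    rw [leg23Hom_op1]
    exact (twoSites 𝒱 hπ heven).map _
  right := (twoSites 𝒱 hπ heven).map _
  swap_right := commute_leg12Hom_leg23Hom_op2 _ _
  swap_left := (commute_leg12Hom_op1 _ _).symm
  comm := commute_leg12Hom_op1 _ _
  braid := P_braid 𝒱

theorem RXX_eq_P_mul_xxBraid (l : ℂ) :
    RXX 𝒱 π l = P 𝒱 * xxBraid (hop (P 𝒱) (op1 (C π)) (op2 (C π))) l := by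
  have H := twoSites 𝒱 hπ heven
  have hP (X) : P 𝒱 * (P 𝒱 * X) = X := by rw [← mul_assoc, P_mul_P, one_mul]
  rw [RXX, xxBraid, H.hop_sq, Sig_eq_distinctProj, mul_add, mul_add, mul_smul_comm, mul_smul_comm,
    mul_sub, sub_mul, H.commute_swap_distinctProj.eq, hop, hP, mul_one, one_mul]

end GradedPermutation

section HubbardR

variable {V W E F : Type*} [AddCommGroup V] [Module ℂ V] [AddCommGroup W] [Module ℂ W]
  [AddCommGroup E] [Module ℂ E] [AddCommGroup F] [Module ℂ F]
  (𝒱 : ZMod 2 → Submodule ℂ V) [DirectSum.Decomposition 𝒱]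
  (𝒲 : ZMod 2 → Submodule ℂ W) [DirectSum.Decomposition 𝒲]

variable (E F) in
/-- `Module.endTensorEndAlgHom` with all scalars equal to `ℂ`: it turns identities in
`End E ⊗ End F` into identities of operators on `E ⊗ F`. -/
def tensorEnd : Module.End ℂ E ⊗[ℂ] Module.End ℂ F →ₐ[ℂ] Module.End ℂ (E ⊗[ℂ] F) :=
  Module.endTensorEndAlgHom

theorem tensorEnd_tmul (X : Module.End ℂ E) (Y : Module.End ℂ F) :
    tensorEnd E F (X ⊗ₜ Y) = TensorProduct.map X Y :=
  rfl

theorem hubbardR_conj (πup : Module.End ℂ V) (πdn : Module.End ℂ W) (h : ℂ → ℂ)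
    (ι : Module.End ℂ (V ⊗[ℂ] V) → Module.End ℂ E)
    (κ : Module.End ℂ (W ⊗[ℂ] W) → Module.End ℂ F) (a b : Module.End ℂ E)
    (a' b' : Module.End ℂ F) (x y : ℂ) :
    hubbardR 𝒱 𝒲 πup πdn h (a * ι · * b) (a' * κ · * b') x y =
      tensorEnd E F (a ⊗ₜ a') * hubbardR 𝒱 𝒲 πup πdn h ι κ x y * tensorEnd E F (b ⊗ₜ b') := by
  simp only [hubbardR, tensorEnd_tmul, TensorProduct.map_mul, mul_add, add_mul, mul_smul_comm,
    smul_mul_assoc]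

variable {πup : Module.End ℂ V} (hπup : IsIdempotentElem πup)
  (hπup_even : ∀ i, ∀ v ∈ 𝒱 i, πup v ∈ 𝒱 i)
  {πdn : Module.End ℂ W} (hπdn : IsIdempotentElem πdn) (hπdn_even : ∀ i, ∀ w ∈ 𝒲 i, πdn w ∈ 𝒲 i)
include hπup hπup_even hπdn hπdn_even

theorem hubbardR_eq_hubbardBraid (f : Module.End ℂ (V ⊗[ℂ] V) →ₐ[ℂ] Module.End ℂ E)
    (f' : Module.End ℂ (W ⊗[ℂ] W) →ₐ[ℂ] Module.End ℂ F) (h : ℂ → ℂ) (x y : ℂ) :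
    hubbardR 𝒱 𝒲 πup πdn h f f' x y =
      tensorEnd E F (f (P 𝒱) ⊗ₜ f' (P 𝒲) *
        hubbardBraid (coupling h x y)
          (hop (f (P 𝒱)) (f (op1 (C πup))) (f (op2 (C πup)))) (f (op1 (C πup)))
          (hop (f' (P 𝒲)) (f' (op1 (C πdn))) (f' (op2 (C πdn)))) (f' (op1 (C πdn))) x y) := by
  simp only [hubbardR, hubbardBraid, Fintype.sum_bool, RXX_eq_P_mul_xxBraid 𝒱 hπup hπup_even,
    RXX_eq_P_mul_xxBraid 𝒲 hπdn hπdn_even, decorated, map_mul, map_xxBraid, map_hop, mul_add,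
    mul_smul_comm, Algebra.TensorProduct.tmul_mul_tmul, map_add, map_smul,
    tensorEnd_tmul, mul_assoc, Bool.toNat_true, Bool.toNat_false, pow_zero,
    pow_one, one_smul]
  rw [add_comm]

theorem hubbard_yangBaxter {h : ℂ → ℂ} {x y z : ℂ}
    (hk : HubbardCouplings x y z (coupling h x y) (coupling h x z) (coupling h y z)) :
    hubbardThree12 𝒱 𝒲 πup πdn h x y * hubbardThree13 𝒱 𝒲 πup πdn h x z *
        hubbardThree23 𝒱 𝒲 πup πdn h y z =
      hubbardThree23 𝒱 𝒲 πup πdn h y z * hubbardThree13 𝒱 𝒲 πup πdn h x z *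
        hubbardThree12 𝒱 𝒲 πup πdn h x y := by
  have h₁₂ (x y : ℂ) : hubbardR 𝒱 𝒲 πup πdn h leg12 leg12 x y = _ :=
    hubbardR_eq_hubbardBraid 𝒱 𝒲 hπup hπup_even hπdn hπdn_even (leg12Hom V) (leg12Hom W) h x y
  have h₂₃ : hubbardR 𝒱 𝒲 πup πdn h leg23 leg23 y z = _ :=
    hubbardR_eq_hubbardBraid 𝒱 𝒲 hπup hπup_even hπdn hπdn_even (leg23Hom V) (leg23Hom W) h y z
  have h₁₃ : hubbardR 𝒱 𝒲 πup πdn h (leg13 𝒱) (leg13 𝒲) x z = _ :=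
    hubbardR_conj 𝒱 𝒲 πup πdn h leg12 leg12 (leg23Hom V (P 𝒱)) (leg23Hom V (P 𝒱))
      (leg23Hom W (P 𝒲)) (leg23Hom W (P 𝒲)) x z
  have hbraid := ThreeSites.hubbard_yangBaxter (A := Module.End ℂ (V ⊗[ℂ] V ⊗[ℂ] V))
    (B := Module.End ℂ (W ⊗[ℂ] W ⊗[ℂ] W)) (threeSites 𝒱 hπup hπup_even)
    (threeSites 𝒲 hπdn hπdn_even) hk
  rw [hubbardThree12, hubbardThree13, hubbardThree23, h₁₃, h₁₂, h₁₂, h₂₃]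
  simp only [← leg23Hom_op1, ← map_mul, hbraid]

theorem hubbard12_mul_hubbard21 (h : ℂ → ℂ) (x y : ℂ) :
    hubbard12 𝒱 𝒲 πup πdn h x y * hubbard21 𝒱 𝒲 πup πdn h y x =
      (Complex.cos (x - y) ^ 4 - coupling h x y ^ 2 * Complex.cos (x + y) ^ 4) • 1 := by
  have H := twoSites 𝒱 hπup hπup_even
  have H' := twoSites 𝒲 hπdn hπdn_even
  have h₁₂ (x y : ℂ) : hubbardR 𝒱 𝒲 πup πdn h id id x y = _ :=
    hubbardR_eq_hubbardBraid 𝒱 𝒲 hπup hπup_even hπdn hπdn_even (.id ℂ _) (.id ℂ _) h x y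
  have h₂₁ : hubbardR 𝒱 𝒲 πup πdn h (leg21 𝒱) (leg21 𝒲) y x = _ :=
    hubbardR_conj 𝒱 𝒲 πup πdn h id id (P 𝒱) (P 𝒱) (P 𝒲) (P 𝒲) y x
  have hP : P 𝒱 ⊗ₜ[ℂ] P 𝒲 * P 𝒱 ⊗ₜ P 𝒲 = 1 := by
    rw [Algebra.TensorProduct.tmul_mul_tmul, H.swap_sq, H'.swap_sq, Algebra.TensorProduct.one_def]
  have hbraid := hubbardBraid_mul_swap H.hop_cube ((pow_two _).trans H.left_sq) H.left_anticomm_hop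
    H'.hop_cube ((pow_two _).trans H'.left_sq) H'.left_anticomm_hop (coupling h x y) x y
  rw [hubbard12, hubbard21, h₂₁, h₁₂, h₁₂, coupling_swap h x y]
  simp only [← map_mul, AlgHom.id_apply]
  rw [← mul_assoc (P 𝒱 ⊗ₜ P 𝒲) (P 𝒱 ⊗ₜ P 𝒲), hP, one_mul, mul_assoc, ← mul_assoc _ _ (_ ⊗ₜ _),
    hbraid, smul_one_mul, mul_smul_comm, hP, map_smul, Algebra.TensorProduct.one_def,
    tensorEnd_tmul, TensorProduct.map_one]

end HubbardR

end UniversalHubbard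

end

theorem mainTheorem2 {V W : Type*} [AddCommGroup V] [Module ℂ V] [AddCommGroup W] [Module ℂ W]
    (𝒱 : ZMod 2 → Submodule ℂ V) [DirectSum.Decomposition 𝒱]
    (𝒲 : ZMod 2 → Submodule ℂ W) [DirectSum.Decomposition 𝒲]
    (πup : Module.End ℂ V) (hπup : IsIdempotentElem πup)
    (hπup_even : ∀ i, ∀ v ∈ 𝒱 i, πup v ∈ 𝒱 i)
    (πdn : Module.End ℂ W) (hπdn : IsIdempotentElem πdn)
    (hπdn_even : ∀ i, ∀ w ∈ 𝒲 i, πdn w ∈ 𝒲 i)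
    (U : ℂ) (h : ℂ → ℂ) (hh : ∀ l : ℂ, Complex.sinh (2 * h l) = U * Complex.sin (2 * l)) :
    (∀ l₁ l₂ l₃ : ℂ,
      Complex.sin (l₁ + l₂) ≠ 0 → Complex.sin (l₁ + l₃) ≠ 0 → Complex.sin (l₂ + l₃) ≠ 0 →
      Complex.cosh (h l₁ + h l₂) ≠ 0 → Complex.cosh (h l₁ + h l₃) ≠ 0 →
      Complex.cosh (h l₂ + h l₃) ≠ 0 →
        UniversalHubbard.hubbardThree12 𝒱 𝒲 πup πdn h l₁ l₂ *
            UniversalHubbard.hubbardThree13 𝒱 𝒲 πup πdn h l₁ l₃ *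
            UniversalHubbard.hubbardThree23 𝒱 𝒲 πup πdn h l₂ l₃ =
          UniversalHubbard.hubbardThree23 𝒱 𝒲 πup πdn h l₂ l₃ *
            UniversalHubbard.hubbardThree13 𝒱 𝒲 πup πdn h l₁ l₃ *
            UniversalHubbard.hubbardThree12 𝒱 𝒲 πup πdn h l₁ l₂) ∧
    (∀ l₁ l₂ : ℂ, Complex.sin (l₁ + l₂) ≠ 0 → Complex.cosh (h l₁ + h l₂) ≠ 0 →
      UniversalHubbard.hubbard12 𝒱 𝒲 πup πdn h l₁ l₂ *
          UniversalHubbard.hubbard21 𝒱 𝒲 πup πdn h l₂ l₁ =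
        (Complex.cos (l₁ - l₂) ^ 4 -
          (Complex.sin (l₁ - l₂) / Complex.sin (l₁ + l₂) * Complex.tanh (h l₁ + h l₂)) ^ 2 *
            Complex.cos (l₁ + l₂) ^ 4) •
          (1 : Module.End ℂ ((V ⊗[ℂ] V) ⊗[ℂ] (W ⊗[ℂ] W)))) ∧
    (∀ l₁ l₂ : ℂ, Complex.sin (l₁ + l₂) ≠ 0 → Complex.cosh (h l₁ + h l₂) ≠ 0 →
      Complex.cosh (h l₁ - h l₂) ≠ 0 →
        Complex.cos (l₁ - l₂) ^ 4 -
            (Complex.sin (l₁ - l₂) / Complex.sin (l₁ + l₂) * Complex.tanh (h l₁ + h l₂)) ^ 2 *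
              Complex.cos (l₁ + l₂) ^ 4 =
          Complex.cos (l₁ - l₂) ^ 2 *
            (Complex.cos (l₁ - l₂) ^ 2 -
              (Complex.tanh (h l₁ - h l₂) * Complex.cos (l₁ + l₂)) ^ 2)) ∧
    (∀ l₁ l₂ : ℂ, Complex.sin (l₁ + l₂) ≠ 0 → Complex.cos (l₁ + l₂) ≠ 0 →
      Complex.cosh (h l₁ + h l₂) ≠ 0 → Complex.cosh (h l₁ - h l₂) ≠ 0 →
        Complex.cos (l₁ - l₂) ^ 4 -
            (Complex.sin (l₁ - l₂) / Complex.sin (l₁ + l₂) * Complex.tanh (h l₁ + h l₂)) ^ 2 =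
          Complex.cos (l₁ - l₂) ^ 2 *
            (Complex.cos (l₁ - l₂) ^ 2 -
              (Complex.tanh (h l₁ - h l₂) / Complex.cos (l₁ + l₂)) ^ 2)) := by
  open UniversalHubbard in
  refine ⟨fun x y z hxy hxz hyz hxy' hxz' hyz' => ?_, fun x y _ _ => ?_, fun x y hs hc hc' => ?_,
    fun x y hs hs' hc hc' => ?_⟩
  · exact hubbard_yangBaxter 𝒱 𝒲 hπup hπup_even hπdn hπdn_even
      (hubbardCouplings_coupling hh hxy hxz hyz hxy' hxz' hyz')
  · exact hubbard12_mul_hubbard21 𝒱 𝒲 hπup hπup_even hπdn hπdn_even h x y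
  · calc Complex.cos (x - y) ^ 4 - coupling h x y ^ 2 * Complex.cos (x + y) ^ 4
        = Complex.cos (x - y) ^ 4 -
            (coupling h x y * Complex.cos (x + y)) ^ 2 * Complex.cos (x + y) ^ 2 := by ring
      _ = _ := by rw [coupling_mul_cos hh hs hc hc']; ring
  · calc Complex.cos (x - y) ^ 4 - coupling h x y ^ 2
        = Complex.cos (x - y) ^ 4 -
            (Complex.tanh (h x - h y) * Complex.cos (x - y) / Complex.cos (x + y)) ^ 2 := by
          rw [eq_div_of_mul_eq hs' (coupling_mul_cos hh hs hc hc')]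
      _ = _ := by ring
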